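/- Let $\sigma\colon\mathbb{R}\times\Omega\to\Omega$, $(t,\omega)\mapsto\omega\cdot t$, be a continuous flow on a compact metric space $\Omega$ that is minimal, i.e. every orbit is dense. A Borel probability measure on $\Omega$ is called ergodic if it is $\sigma$-invariant and gives measure $0$ or $1$ to every $\sigma$-invariant Borel set. Let $C(\Omega)$ be the space of continuous functions $a\colon\Omega\to\mathbb{R}$ with the norm $\|a\|=\max_{\omega\in\Omega}|a(\omega)|$, and let $C_0(\Omega)$ be the subspace of those $a$ with $\int_\Omega a\,dm=0$ for every ergodic measure $m$. For $a\in C(\Omega)$, the family $x'=a(\omega\cdot t)\,x$ has exponential dichotomy over $\Omega$ if there are $k\ge1$ and $\delta>0$ such that either $\exp\int_0^t a(\omega\cdot s)\,ds\le k e^{-\delta t}$ for all $\omega\in\Omega$ and $t\ge0$, or $\exp\int_0^t a(\omega\cdot s)\,ds\le k e^{\delta t}$ for all $\omega\in\Omega$ and $t\le0$. The Sacker–Sell spectrum $\mathrm{sp}(a)$ is the set of $\lambda\in\mathbb{R}$ such that the family $x'=(a(\omega\cdot t)-\lambda)\,x$ does not have exponential dichotomy over $\Omega$. Assume that there are exactly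 $n\ge1$ ergodic measures, $m_1,\dots,m_n$ (pairwise different). For $0<\epsilon<1$, call $(c_1,\dots,c_n)$ an $\epsilon$-separating family if the functions $c_i\colon\Omega\to[0,1]$ are continuous with $\min_\Omega c_i=0$ and $\max_\Omega c_i=1$, $c_ic_j\equiv0$ for $i\ne j$, and $$1-\epsilon<\int_\Omega c_i\,dm_i\le1,\qquad 0\le\int_\Omega c_i\,dm_j<\epsilon\qquad(j\ne i).$$ Then there exists $\epsilon_2\in(0,1)$ such that for every $\epsilon$ with $0<\epsilon\le\epsilon_2$ the following hold. (1) If $\Omega$ has more than one point, then an $\epsilon$-separating family exists. (2) For every $\epsilon$-separating family $(c_1,\dots,c_n)$, $$C(\Omega)=\langle c_1,\dots,c_n\rangle\oplus C_0(\Omega)$$ as a topological direct sum of vector spaces, i.e. the sum is direct and the projections onto the two summands are continuous; and, for every $a\in C(\Omega)$, if $P a$ denotes the projection of $a$ onto $\langle c_1,\dots,c_n\rangle$ along $C_0(\Omega)$, then $\mathrm{sp}(a)=\mathrm{sp}(P a)$. -/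

import Mathlib

open MeasureTheory Set

noncomputable section

/-- The real flow `φ` is minimal: every orbit is dense. -/
def IsMinimalFlow {Ω : Type*} [TopologicalSpace Ω] (φ : Flow ℝ Ω) : Prop :=
  ∀ ω : Ω, Dense (φ.orbit ω)

/-- `μ` is an ergodic measure of the flow `φ`: a Borel probability measure, invariant under
all the maps `φ t`, that gives measure `0` or `1` to every invariant Borel set. -/
structure IsErgodicMeasure {Ω : Type*} [TopologicalSpace Ω] [MeasurableSpace Ω]
    (φ : Flow ℝ Ω) (μ : Measure Ω) : Prop where
  isProbabilityMeasure : IsProbabilityMeasure μ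
  measurePreserving : ∀ t : ℝ, MeasurePreserving (φ t) μ μ
  zero_or_one : ∀ B : Set Ω, MeasurableSet B → (∀ t : ℝ, φ t '' B = B) → μ B = 0 ∨ μ B = 1

/-- The set of all ergodic measures of the flow `φ`. -/
def ergodicMeasures {Ω : Type*} [TopologicalSpace Ω] [MeasurableSpace Ω]
    (φ : Flow ℝ Ω) : Set (Measure Ω) :=
  {μ | IsErgodicMeasure φ μ}

theorem ContinuousMap.integrable_of_isErgodicMeasure {Ω : Type*} [TopologicalSpace Ω]
    [CompactSpace Ω] [MeasurableSpace Ω] [BorelSpace Ω] {φ : Flow ℝ Ω} {μ : Measure Ω}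
    (hμ : IsErgodicMeasure φ μ) (a : C(Ω, ℝ)) : Integrable (fun ω => a ω) μ := by
  have := hμ.isProbabilityMeasure
  exact a.continuous.integrable_of_hasCompactSupport (HasCompactSupport.of_compactSpace _)

/-- The space `C₀(Ω)` of the continuous functions on `Ω` whose integral with respect to every
ergodic measure of the flow vanishes. -/
def zeroMeanFunctions {Ω : Type*} [TopologicalSpace Ω] [CompactSpace Ω] [MeasurableSpace Ω]
    [BorelSpace Ω] (φ : Flow ℝ Ω) : Submodule ℝ C(Ω, ℝ) where
  carrier := {a | ∀ μ ∈ ergodicMeasures φ, ∫ ω, a ω ∂μ = 0}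
  zero_mem' := by
    intro μ _
    simp
  add_mem' := by
    intro a b ha hb μ hμ
    have h := integral_add (a.integrable_of_isErgodicMeasure hμ)
      (b.integrable_of_isErgodicMeasure hμ)
    simpa [ha μ hμ, hb μ hμ] using h
  smul_mem' := by
    intro r a ha μ hμ
    have h := integral_const_mul (μ := μ) r (fun ω => a ω)
    simpa [ha μ hμ] using h

/-- The family of linear equations `x' = a(φ t ω) x`, `ω ∈ Ω`, has exponential dichotomy
over `Ω`. -/
def HasExponentialDichotomy {Ω : Type*} [TopologicalSpace Ω] (φ : Flow ℝ Ω)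
    (a : C(Ω, ℝ)) : Prop :=
  ∃ k δ : ℝ, 1 ≤ k ∧ 0 < δ ∧
    ((∀ (ω : Ω) (t : ℝ), 0 ≤ t →
        Real.exp (∫ s in (0 : ℝ)..t, a (φ s ω)) ≤ k * Real.exp (-δ * t)) ∨
      (∀ (ω : Ω) (t : ℝ), t ≤ 0 →
        Real.exp (∫ s in (0 : ℝ)..t, a (φ s ω)) ≤ k * Real.exp (δ * t)))

/-- The Sacker-Sell spectrum of `a`: the set of the real `r` such that the family
`x' = (a(φ t ω) - r) x` does not have exponential dichotomy over `Ω`. -/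
def sackerSellSpectrum {Ω : Type*} [TopologicalSpace Ω] (φ : Flow ℝ Ω)
    (a : C(Ω, ℝ)) : Set ℝ :=
  {r | ¬ HasExponentialDichotomy φ (a - ContinuousMap.const Ω r)}

/-- The continuous functions `c i : Ω → [0,1]` have minimum `0` and maximum `1`, pairwise zero
products, and `c i` has integral in `(1 - ε, 1]` for `m i` and in `[0, ε)` for `m j`, `j ≠ i`. -/
structure IsSeparatingFamily {Ω : Type*} [TopologicalSpace Ω] [MeasurableSpace Ω] {n : ℕ}
    (m : Fin n → Measure Ω) (ε : ℝ) (c : Fin n → C(Ω, ℝ)) : Prop where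
  mem_Icc : ∀ i ω, c i ω ∈ Icc (0 : ℝ) 1
  isLeast : ∀ i, IsLeast (range (c i)) 0
  isGreatest : ∀ i, IsGreatest (range (c i)) 1
  mul_eq_zero : ∀ i j, i ≠ j → c i * c j = 0
  integral_self : ∀ i, ∫ ω, c i ω ∂(m i) ∈ Ioc (1 - ε) 1
  integral_other : ∀ i j, j ≠ i → ∫ ω, c i ω ∂(m j) ∈ Ico 0 ε

end

/-! Distinct ergodic measures are mutually singular, and they have no atoms when `Ω` has more than
one point, since minimality makes every orbit infinite. By inner regularity they nearly live on
disjoint compact sets, and distance bumps around these sets form the separating family.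

For the direct sum, the matrix `∫ c i ∂(m j)` is strictly diagonally dominant along columns once `ε
* n < 1`. Hence integration against the `m j` maps the span of the `c i` isomorphically onto `Fin n
→ ℝ`, and the kernel of this map on all of `C(Ω, ℝ)` is `C₀(Ω)`.

For the spectrum, `a - P a` lies in `C₀(Ω)`. Krein–Milman extends vanishing against ergodic measures
to all invariant states (`apply_eq_zero_of_mem_zeroMeanFunctions`). Weak-* compactness then makes
integrals along orbits sublinear, uniformly in the initial point (`exists_abs_integral_orbit_le`),
so adding a function of `C₀(Ω)` costs only part of the dichotomy rate. -/

/-! ### Singularity and absence of atoms for ergodic measures. -/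

section Ergodic

variable {Ω : Type*} [MetricSpace Ω] [CompactSpace Ω] [MeasurableSpace Ω] [BorelSpace Ω]
  {φ : Flow ℝ Ω} {μ ν : Measure Ω}

/-- An ergodic measure of a flow gives measure `0` or `1` to every set that is invariant up to
null sets. -/
theorem IsErgodicMeasure.zero_or_one_of_ae_invariant (hμ : IsErgodicMeasure φ μ) {A : Set Ω}
    (hA : MeasurableSet A) (h : ∀ t : ℝ, φ t ⁻¹' A =ᵐ[μ] A) : μ A = 0 ∨ μ A = 1 := by
  have := hμ.isProbabilityMeasure
  -- Translation invariance of Lebesgue measure makes `B` strictly invariant, and Fubini shows that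
  -- it differs from `A` by a null set.
  let B : Set Ω := {ω | ∀ᵐ t : ℝ, φ t ω ∈ A}
  have hcont : Continuous fun p : Ω × ℝ => φ p.2 p.1 := by fun_prop
  have hB : MeasurableSet B := by
    have h1 : Measurable fun ω : Ω =>
        (volume : Measure ℝ) (Prod.mk ω ⁻¹' ((fun p : Ω × ℝ => φ p.2 p.1) ⁻¹' Aᶜ)) :=
      measurable_measure_prodMk_left (hcont.measurable hA.compl)
    exact h1 (measurableSet_singleton 0)
  have hmem : ∀ (s : ℝ) (ω : Ω), ω ∈ B → φ s ω ∈ B := by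
    intro s ω hω
    have h2 := (measurePreserving_add_right (volume : Measure ℝ) s).quasiMeasurePreserving.ae hω
    change ∀ᵐ t : ℝ, φ t (φ s ω) ∈ A
    filter_upwards [h2] with t ht
    rwa [← φ.map_add]
  have hinv : ∀ t : ℝ, φ t '' B = B := by
    intro t
    refine Subset.antisymm (image_subset_iff.2 fun ω hω => hmem t ω hω) fun ω hω => ?_
    refine ⟨φ (-t) ω, hmem _ _ hω, ?_⟩
    rw [← φ.map_add, add_neg_cancel, φ.map_zero_apply]
  have hAB : A =ᵐ[μ] B := by
    have h3 : ∀ᵐ ω ∂μ, ∀ᵐ t : ℝ, (φ t ω ∈ A ↔ ω ∈ A) := by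
      refine (Measure.ae_ae_comm ?_).2 (Filter.Eventually.of_forall fun t => ?_)
      · have h4 : MeasurableSet ((fun p : Ω × ℝ => φ p.2 p.1) ⁻¹' A) := hcont.measurable hA
        have h5 : MeasurableSet ((fun p : Ω × ℝ => p.1) ⁻¹' A) := measurable_fst hA
        exact h4.iff h5
      · exact (Filter.eventuallyEq_set.1 (h t))
    refine Filter.eventuallyEq_set.2 ?_
    filter_upwards [h3] with ω hω
    constructor
    · intro hωA
      filter_upwards [hω] with t ht using ht.2 hωA
    · intro hωB
      obtain ⟨t, ht1, ht2⟩ := (hω.and (show ∀ᵐ t : ℝ, φ t ω ∈ A from hωB)).exists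
      exact ht1.1 ht2
  rw [measure_congr hAB]
  exact hμ.zero_or_one B hB hinv

/-- The density of `ν` with respect to `μ` is invariant almost everywhere, so ergodicity makes it
constant. -/
theorem IsErgodicMeasure.exists_eq_singularPart_add_smul (hμ : IsErgodicMeasure φ μ)
    [IsFiniteMeasure ν] (hν : ∀ t : ℝ, MeasurePreserving (φ t) ν ν) :
    ∃ c : ENNReal, ν = ν.singularPart μ + c • μ := by
  have := hμ.isProbabilityMeasure
  obtain ⟨c, hc⟩ : ∃ c : ENNReal, ν.rnDeriv μ =ᵐ[μ] Function.const Ω c := by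
    refine Filter.exists_eventuallyEq_const_of_forall_separating MeasurableSet fun U hU => ?_
    have hm : MeasurableSet (ν.rnDeriv μ ⁻¹' U) := Measure.measurable_rnDeriv ν μ hU
    have hinv : ∀ t : ℝ, φ t ⁻¹' (ν.rnDeriv μ ⁻¹' U) =ᵐ[μ] ν.rnDeriv μ ⁻¹' U := fun t => by
      have h1 := (hν t).rnDeriv_comp_aeEq (hμ.measurePreserving t)
      refine Filter.eventuallyEq_set.2 ?_
      filter_upwards [h1] with ω hω
      simp only [mem_preimage]
      rw [← hω]
      rfl
    rcases hμ.zero_or_one_of_ae_invariant hm hinv with h | h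
    · right
      exact measure_eq_zero_iff_ae_notMem.1 h
    · left
      exact mem_ae_iff_prob_eq_one hm |>.2 h
  refine ⟨c, ?_⟩
  conv_lhs => rw [ν.haveLebesgueDecomposition_add μ, withDensity_congr_ae hc]
  congr 1
  exact withDensity_const c

/-- If the constant density `c` is nonzero, then `μ ≪ ν`, so `μ` is a multiple of `ν`, and equal
total masses force `μ = ν`. -/
theorem IsErgodicMeasure.mutuallySingular (hμ : IsErgodicMeasure φ μ) (hν : IsErgodicMeasure φ ν)
    (hne : μ ≠ ν) : μ ⟂ₘ ν := by
  have := hμ.isProbabilityMeasure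
  have := hν.isProbabilityMeasure
  obtain ⟨c, hc⟩ := hμ.exists_eq_singularPart_add_smul hν.measurePreserving
  obtain ⟨d, hd⟩ := hν.exists_eq_singularPart_add_smul hμ.measurePreserving
  by_cases hc0 : c = 0
  · rw [hc0, zero_smul, add_zero] at hc
    rw [hc]
    exact (Measure.mutuallySingular_singularPart ν μ).symm
  · have hac : μ ≪ ν := by
      refine (Measure.absolutelyContinuous_smul hc0).trans ?_
      conv_rhs => rw [hc]
      exact Measure.absolutelyContinuous_of_le (Measure.le_add_left le_rfl)
    rw [Measure.singularPart_eq_zero_of_ac hac, zero_add] at hd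
    have h1 := congrArg (fun m : Measure Ω => m univ) hd
    simp only [measure_univ, Measure.smul_apply, smul_eq_mul, mul_one] at h1
    rw [← h1, one_smul] at hd
    exact absurd hd hne

/-- An atom would give all points of its orbit mass at least its own. The orbit is connected and
dense, hence infinite, so the total mass would be infinite. -/
theorem IsErgodicMeasure.measure_singleton [Nontrivial Ω] (hφ : IsMinimalFlow φ)
    (hμ : IsErgodicMeasure φ μ) (ω : Ω) : μ {ω} = 0 := by
  have := hμ.isProbabilityMeasure
  have hinf : (φ.orbit ω).Infinite := by
    refine IsPreconnected.infinite_of_nontrivial ?_ ?_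
    · rw [Flow.orbit_eq_range]
      exact isPreconnected_range (by fun_prop)
    · rw [← not_subsingleton_iff]
      intro hs
      have h1 : closure (φ.orbit ω) = φ.orbit ω := hs.isClosed.closure_eq
      rw [(hφ ω).closure_eq] at h1
      rw [← h1] at hs
      exact not_subsingleton_iff.2 nontrivial_univ hs
  by_contra h0
  refine measure_ne_top μ _ (hinf.meas_eq_top ⟨μ {ω}, h0, ?_⟩)
  rw [Flow.orbit_eq_range]
  rintro _ ⟨t, rfl⟩
  have h2 := (hμ.measurePreserving t).measure_preimage
    (measurableSet_singleton (φ t ω)).nullMeasurableSet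
  simp only
  rw [← h2]
  exact measure_mono (by simp)

end Ergodic

/-! ### Bump functions built from distances. -/

section DistBump

variable {Ω : Type*} [MetricSpace Ω]

/-- A continuous function with values in `[0,1]` that equals `1` on `K`, `0` on `F`, and is positive
only at points nearer to `K` than to `F`. -/
noncomputable def distBump (K F : Set Ω) (hK : IsClosed K) (hF : IsClosed F) (hKne : K.Nonempty)
    (hFne : F.Nonempty) (hd : Disjoint K F) : C(Ω, ℝ) where
  toFun ω := max 0 ((Metric.infDist ω F - Metric.infDist ω K) /
    (Metric.infDist ω F + Metric.infDist ω K))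
  continuous_toFun := by
    refine continuous_const.max (Continuous.div
      ((Metric.continuous_infDist_pt F).sub (Metric.continuous_infDist_pt K))
      ((Metric.continuous_infDist_pt F).add (Metric.continuous_infDist_pt K)) fun ω => ?_)
    by_cases h : ω ∈ K
    · have h1 := (hF.notMem_iff_infDist_pos hFne).1 (Set.disjoint_left.1 hd h)
      have h2 := Metric.infDist_nonneg (x := ω) (s := K)
      positivity
    · have h1 := (hK.notMem_iff_infDist_pos hKne).1 h
      have h2 := Metric.infDist_nonneg (x := ω) (s := F)
      positivity

variable {K F : Set Ω} {hK : IsClosed K} {hF : IsClosed F} {hKne : K.Nonempty}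
    {hFne : F.Nonempty} {hd : Disjoint K F}

theorem distBump_mem_Icc (ω : Ω) : distBump K F hK hF hKne hFne hd ω ∈ Icc (0 : ℝ) 1 := by
  have h1 := Metric.infDist_nonneg (x := ω) (s := K)
  have h2 := Metric.infDist_nonneg (x := ω) (s := F)
  exact ⟨le_max_left _ _, max_le zero_le_one (div_le_one_of_le₀ (by linarith) (by linarith))⟩

theorem distBump_eq_one {ω : Ω} (h : ω ∈ K) : distBump K F hK hF hKne hFne hd ω = 1 := by
  have h1 := (hF.notMem_iff_infDist_pos hFne).1 (Set.disjoint_left.1 hd h)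
  change max 0 ((Metric.infDist ω F - Metric.infDist ω K) /
    (Metric.infDist ω F + Metric.infDist ω K)) = 1
  rw [Metric.infDist_zero_of_mem h, sub_zero, add_zero, div_self h1.ne']
  exact max_eq_right zero_le_one

theorem distBump_eq_zero {ω : Ω} (h : Metric.infDist ω F ≤ Metric.infDist ω K) :
    distBump K F hK hF hKne hFne hd ω = 0 := by
  have h1 := Metric.infDist_nonneg (x := ω) (s := K)
  have h2 := Metric.infDist_nonneg (x := ω) (s := F)
  exact max_eq_left (div_nonpos_of_nonpos_of_nonneg (by linarith) (by linarith))

theorem distBump_eq_zero_of_mem {ω : Ω} (h : ω ∈ F) :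
    distBump K F hK hF hKne hFne hd ω = 0 :=
  distBump_eq_zero (by rw [Metric.infDist_zero_of_mem h]; exact Metric.infDist_nonneg)

end DistBump

/-! ### Existence of separating families. -/

section Separating

variable {Ω : Type*} [MetricSpace Ω] [CompactSpace Ω] [MeasurableSpace Ω] [BorelSpace Ω]

/-- Mutually singular probability measures without an atom at `x` are nearly concentrated on
disjoint compact sets that do not contain `x`. -/
theorem exists_isCompact_pairwise_disjoint {n : ℕ} {m : Fin n → Measure Ω}
    [∀ i, IsProbabilityMeasure (m i)] (hm : ∀ i j, i ≠ j → m i ⟂ₘ m j) {x : Ω}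
    (hx : ∀ i, m i {x} = 0) {ε : ℝ} (hε : 0 < ε) :
    ∃ K : Fin n → Set Ω, (∀ i, IsCompact (K i)) ∧ (∀ i j, i ≠ j → Disjoint (K i) (K j)) ∧
      (∀ i, x ∉ K i) ∧ ∀ i, (m i).real (K i)ᶜ < ε := by
  let N : Fin n → Fin n → Set Ω := fun i j => if h : i ≠ j then (hm i j h).nullSet else ∅
  have hNm : ∀ i j, MeasurableSet (N i j) := fun i j => by
    by_cases h : i ≠ j
    · simpa [N, h] using (hm i j h).measurableSet_nullSet
    · obtain rfl := not_not.1 h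
      simp [N]
  have hN0 : ∀ i j, m i (N i j) = 0 := fun i j => by
    by_cases h : i ≠ j
    · simp [N, h]
    · obtain rfl := not_not.1 h
      simp [N]
  have hN1 : ∀ i j, i ≠ j → m j (N i j)ᶜ = 0 := fun i j h => by
    simp [N, h]
  -- For `i ≠ j`, `B i` lies inside `N j i` while `B j` avoids it, so the sets are disjoint; only `m
  -- i`-null sets are removed to form `B i`.
  let B : Fin n → Set Ω := fun i => ({x} ∪ ⋃ j, (N i j ∪ if i ≠ j then (N j i)ᶜ else ∅))ᶜ
  have hBm : ∀ i, MeasurableSet (B i) := fun i => by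
    refine ((measurableSet_singleton x).union (MeasurableSet.iUnion fun j =>
      (hNm i j).union ?_)).compl
    split_ifs
    · exact (hNm j i).compl
    · exact MeasurableSet.empty
  have hB0 : ∀ i, m i (B i)ᶜ = 0 := fun i => by
    rw [compl_compl]
    refine measure_union_null (hx i) (measure_iUnion_null fun j => measure_union_null (hN0 i j) ?_)
    split_ifs with h
    · exact hN1 j i h.symm
    · exact measure_empty
  have hK : ∀ i, ∃ K, K ⊆ B i ∧ IsCompact K ∧ m i (B i \ K) < ENNReal.ofReal ε := fun i =>
    (hBm i).exists_isCompact_sdiff_lt (measure_ne_top _ _) (by simpa using hε)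
  choose K hKB hKc hKε using hK
  refine ⟨K, hKc, fun i j hij => ?_, fun i hi => ?_, fun i => ?_⟩
  · rw [Set.disjoint_left]
    intro ω hi hj
    have h1 := hKB i hi
    have h2 := hKB j hj
    simp only [B, mem_compl_iff, mem_union, mem_iUnion, not_or, not_exists] at h1 h2
    have h3 := (h1.2 j).1
    have h4 := (h2.2 i).2
    rw [if_pos hij.symm] at h4
    exact h4 h3
  · have := hKB i hi
    simp [B] at this
  · rw [measureReal_def, ← ENNReal.lt_ofReal_iff_toReal_lt (measure_ne_top _ _)]
    refine lt_of_le_of_lt ?_ (hKε i)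
    calc m i (K i)ᶜ ≤ m i ((B i \ K i) ∪ (B i)ᶜ) := by
          refine measure_mono fun ω hω => ?_
          by_cases h : ω ∈ B i
          · exact Or.inl ⟨h, hω⟩
          · exact Or.inr h
      _ ≤ m i (B i \ K i) + m i (B i)ᶜ := measure_union_le _ _
      _ = m i (B i \ K i) := by rw [hB0 i, add_zero]

theorem exists_isSeparatingFamily {n : ℕ} {m : Fin n → Measure Ω}
    [∀ i, IsProbabilityMeasure (m i)] (hm : ∀ i j, i ≠ j → m i ⟂ₘ m j) {x : Ω}
    (hx : ∀ i, m i {x} = 0) {ε : ℝ} (hε : 0 < ε) (hε1 : ε < 1) :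
    ∃ c : Fin n → C(Ω, ℝ), IsSeparatingFamily m ε c := by
  obtain ⟨K, hKc, hKd, hxK, hKε⟩ := exists_isCompact_pairwise_disjoint hm hx hε
  have hKne : ∀ i, (K i).Nonempty := fun i => by
    rw [nonempty_iff_ne_empty]
    intro h
    have := hKε i
    simp only [h, compl_empty, probReal_univ] at this
    linarith
  -- The point `x` keeps `F i` nonempty even for `n = 1`, so that each `c i` attains the value `0`.
  let F : Fin n → Set Ω := fun i => insert x (⋃ j ∈ {j | j ≠ i}, K j)
  have hFc : ∀ i, IsClosed (F i) := fun i => by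
    have : IsClosed (⋃ j ∈ {j | j ≠ i}, K j) :=
      (Set.toFinite _).isClosed_biUnion fun j _ => (hKc j).isClosed
    exact isClosed_singleton.union this
  have hKF : ∀ i j, j ≠ i → K j ⊆ F i := fun i j hj =>
    (subset_biUnion_of_mem (u := K) (show j ∈ {j | j ≠ i} from hj)).trans (subset_insert _ _)
  have hd : ∀ i, Disjoint (K i) (F i) := fun i => by
    rw [Set.disjoint_insert_right]
    refine ⟨hxK i, ?_⟩
    rw [Set.disjoint_iUnion₂_right]
    exact fun j hj => hKd i j (Ne.symm hj)
  let c : Fin n → C(Ω, ℝ) := fun i =>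
    distBump (K i) (F i) (hKc i).isClosed (hFc i) (hKne i) ⟨x, mem_insert _ _⟩ (hd i)
  have hc01 : ∀ i ω, c i ω ∈ Icc (0 : ℝ) 1 := fun i ω => distBump_mem_Icc ω
  have hc1 : ∀ i, ∀ ω ∈ K i, c i ω = 1 := fun i ω hω => distBump_eq_one hω
  have hc0 : ∀ i, ∀ ω ∈ F i, c i ω = 0 := fun i ω hω => distBump_eq_zero_of_mem hω
  have hint : ∀ i j, Integrable (fun ω => c i ω) (m j) := fun i j =>
    (c i).continuous.integrable_of_hasCompactSupport (HasCompactSupport.of_compactSpace _)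
  refine ⟨c, hc01, fun i => ⟨⟨x, hc0 i x (mem_insert _ _)⟩, ?_⟩, fun i => ⟨?_, ?_⟩, ?_, ?_, ?_⟩
  · rintro _ ⟨ω, rfl⟩
    exact (hc01 i ω).1
  · obtain ⟨ω, hω⟩ := hKne i
    exact ⟨ω, hc1 i ω hω⟩
  · rintro _ ⟨ω, rfl⟩
    exact (hc01 i ω).2
  · intro i j hij
    ext ω
    change c i ω * c j ω = 0
    -- If `ω` is at least as near to `K i` as to `K j`, it is at least as near to `F j ⊇ K i`, where
    -- the bump for `K j` vanishes.
    rcases le_total (Metric.infDist ω (K i)) (Metric.infDist ω (K j)) with h | h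
    · refine mul_eq_zero_of_right _ (distBump_eq_zero ?_)
      exact (Metric.infDist_le_infDist_of_subset (hKF j i hij) (hKne i)).trans h
    · refine mul_eq_zero_of_left (distBump_eq_zero ?_) _
      exact (Metric.infDist_le_infDist_of_subset (hKF i j hij.symm) (hKne j)).trans h
  · intro i
    constructor
    · have h1 : (m i).real (K i) ≤ ∫ ω, c i ω ∂(m i) := by
        rw [← integral_indicator_one (hKc i).measurableSet]
        refine integral_mono ((integrable_const (1 : ℝ)).indicator (hKc i).measurableSet)
          (hint i i) fun ω => ?_
        by_cases h : ω ∈ K i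
        · simp [h, hc1 i ω h]
        · simp [h, (hc01 i ω).1]
      have h2 := probReal_add_probReal_compl (μ := m i) (hKc i).measurableSet
      have h3 := hKε i
      linarith
    · calc ∫ ω, c i ω ∂(m i) ≤ ∫ _, (1 : ℝ) ∂(m i) :=
            integral_mono (hint i i) (integrable_const _) fun ω => (hc01 i ω).2
        _ = 1 := by simp
  · intro i j hij
    refine ⟨integral_nonneg fun ω => (hc01 i ω).1, lt_of_le_of_lt ?_ (hKε j)⟩
    rw [← integral_indicator_one (hKc j).measurableSet.compl]
    refine integral_mono (hint i j)
      ((integrable_const (1 : ℝ)).indicator (hKc j).measurableSet.compl) fun ω => ?_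
    by_cases h : ω ∈ K j
    · simp [h, hc0 i ω (hKF i j hij h)]
    · simp [h, (hc01 i ω).2]

end Separating

/-! ### Composition with the flow and invariant sets. -/

section Flow

variable {Ω : Type*} [TopologicalSpace Ω]

/-- The composition of a continuous function with the time `t` map of a flow. -/
def ContinuousMap.compFlow (g : C(Ω, ℝ)) (φ : Flow ℝ Ω) (t : ℝ) : C(Ω, ℝ) :=
  g.comp ⟨φ t, φ.continuous_toFun t⟩

@[simp]
theorem ContinuousMap.compFlow_apply (g : C(Ω, ℝ)) (φ : Flow ℝ Ω) (t : ℝ) (ω : Ω) :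
    g.compFlow φ t ω = g (φ t ω) := rfl

theorem Flow.continuous_comp_orbit (φ : Flow ℝ Ω) (g : C(Ω, ℝ)) (ω : Ω) :
    Continuous fun s : ℝ => g (φ s ω) := by fun_prop

theorem preimage_eq_of_image_eq {φ : Flow ℝ Ω} {B : Set Ω} (hB : ∀ t : ℝ, φ t '' B = B) (t : ℝ) :
    φ t ⁻¹' B = B := by
  have hneg : ∀ ω, φ (-t) (φ t ω) = ω := fun ω => by
    rw [← φ.map_add, neg_add_cancel, φ.map_zero_apply]
  refine Subset.antisymm (fun ω hω => ?_) fun ω hω => ?_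
  · rw [← hB (-t)]
    exact ⟨φ t ω, hω, hneg ω⟩
  · rw [mem_preimage, ← hB t]
    exact mem_image_of_mem _ hω

/-- Conditioning on an invariant set preserves invariance. -/
theorem measurePreserving_cond [MeasurableSpace Ω] {φ : Flow ℝ Ω} {μ : Measure Ω}
    (h : ∀ t : ℝ, MeasurePreserving (φ t) μ μ) {B : Set Ω} (hBm : MeasurableSet B)
    (hB : ∀ t : ℝ, φ t ⁻¹' B = B) (t : ℝ) :
    MeasurePreserving (φ t) (ProbabilityTheory.cond μ B) (ProbabilityTheory.cond μ B) := by
  have h1 := (h t).restrict_preimage hBm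
  rw [hB t] at h1
  exact h1.smul_measure _

end Flow

/-! ### Weak-* compactness and convexity of invariant states. -/

section States

variable {Ω : Type*} [TopologicalSpace Ω] [CompactSpace Ω]

theorem LinearMap.norm_apply_le_of_nonneg_of_map_one (f : C(Ω, ℝ) →ₗ[ℝ] ℝ)
    (hf : ∀ g, 0 ≤ g → 0 ≤ f g) (h1 : f 1 = 1) (g : C(Ω, ℝ)) : ‖f g‖ ≤ 1 * ‖g‖ := by
  have hub : g ≤ ‖g‖ • (1 : C(Ω, ℝ)) := fun ω => by
    simpa using (le_abs_self _).trans (g.norm_coe_le_norm ω)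
  have hlb : -g ≤ ‖g‖ • (1 : C(Ω, ℝ)) := fun ω => by
    simpa using (neg_le_abs _).trans (g.norm_coe_le_norm ω)
  have h2 := hf _ (sub_nonneg.2 hub)
  have h3 := hf _ (sub_nonneg.2 hlb)
  simp only [map_sub, map_smul, map_neg, h1, smul_eq_mul] at h2 h3
  rw [Real.norm_eq_abs, abs_le]
  constructor <;> linarith

/-- A positive linear functional on `C(Ω, ℝ)` that maps `1` to `1`, as an element of the dual. -/
noncomputable def WeakDual.ofPositive (f : C(Ω, ℝ) →ₗ[ℝ] ℝ) (hf : ∀ g, 0 ≤ g → 0 ≤ f g)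
    (h1 : f 1 = 1) : WeakDual ℝ C(Ω, ℝ) :=
  StrongDual.toWeakDual <| f.mkContinuous 1 (f.norm_apply_le_of_nonneg_of_map_one hf h1)

/-- The states of `C(Ω, ℝ)`: the positive functionals that map `1` to `1`. -/
def states (Ω : Type*) [TopologicalSpace Ω] [CompactSpace Ω] : Set (WeakDual ℝ C(Ω, ℝ)) :=
  {L | (∀ g, 0 ≤ g → 0 ≤ L g) ∧ L 1 = 1}

/-- Banach–Alaoglu: positivity and normalisation are weak-* closed conditions and bound the norm by
`1`. -/
theorem isCompact_states : IsCompact (states Ω) := by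
  refine IsCompact.of_isClosed_subset (WeakDual.isCompact_closedBall (0 : StrongDual ℝ C(Ω, ℝ)) 1)
    ?_ ?_
  · have : states Ω = (⋂ (g : C(Ω, ℝ)) (_ : 0 ≤ g), {L : WeakDual ℝ C(Ω, ℝ) | 0 ≤ L g}) ∩
        {L : WeakDual ℝ C(Ω, ℝ) | L 1 = 1} := by
      ext L; simp [states]
    rw [this]
    refine IsClosed.inter (isClosed_iInter fun g => isClosed_iInter fun _ => ?_) ?_
    · exact isClosed_le continuous_const (WeakDual.eval_continuous g)
    · exact isClosed_eq (WeakDual.eval_continuous _) continuous_const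
  · intro L hL
    rw [mem_preimage, mem_closedBall_zero_iff]
    exact ContinuousLinearMap.opNorm_le_bound _ zero_le_one
      ((L : C(Ω, ℝ) →L[ℝ] ℝ).toLinearMap.norm_apply_le_of_nonneg_of_map_one hL.1 hL.2)

/-- The states of `C(Ω, ℝ)` that are invariant under a flow. -/
def invariantStates (φ : Flow ℝ Ω) : Set (WeakDual ℝ C(Ω, ℝ)) :=
  {L | L ∈ states Ω ∧ ∀ (t : ℝ) (g : C(Ω, ℝ)), L (g.compFlow φ t) = L g}

theorem isCompact_invariantStates (φ : Flow ℝ Ω) : IsCompact (invariantStates φ) := by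
  refine isCompact_states.of_isClosed_subset ?_ fun L hL => hL.1
  have : invariantStates φ = states Ω ∩
      ⋂ (t : ℝ) (g : C(Ω, ℝ)), {L : WeakDual ℝ C(Ω, ℝ) | L (g.compFlow φ t) = L g} := by
    ext L; simp [invariantStates]
  rw [this]
  refine isCompact_states.isClosed.inter (isClosed_iInter fun t => isClosed_iInter fun g => ?_)
  exact isClosed_eq (WeakDual.eval_continuous _) (WeakDual.eval_continuous _)

theorem convex_invariantStates (φ : Flow ℝ Ω) : Convex ℝ (invariantStates φ) := by
  rintro L ⟨⟨hL, hL1⟩, hLi⟩ M ⟨⟨hM, hM1⟩, hMi⟩ a b ha hb hab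
  have key : ∀ g, (a • L + b • M) g = a * L g + b * M g := fun g => rfl
  refine ⟨⟨fun g hg => ?_, ?_⟩, fun t g => ?_⟩
  · have := hL g hg
    have := hM g hg
    rw [key]
    positivity
  · rw [key, hL1, hM1, mul_one, mul_one, hab]
  · rw [key, key, hLi, hMi]

end States

/-! ### States as probability measures; extreme invariant states are ergodic. -/

section Riesz

variable {Ω : Type*} [MetricSpace Ω] [CompactSpace Ω] [MeasurableSpace Ω] [BorelSpace Ω]

/-- The state given by integration with respect to a probability measure. -/
noncomputable def integralState (μ : Measure Ω) [IsProbabilityMeasure μ] : WeakDual ℝ C(Ω, ℝ) :=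
  WeakDual.ofPositive
    { toFun := fun g => ∫ ω, g ω ∂μ
      map_add' := fun f g => integral_add
        (f.continuous.integrable_of_hasCompactSupport (HasCompactSupport.of_compactSpace _))
        (g.continuous.integrable_of_hasCompactSupport (HasCompactSupport.of_compactSpace _))
      map_smul' := fun r g => integral_const_mul r (fun ω => g ω) }
    (fun _ hg => integral_nonneg hg) (by simp)

@[simp]
theorem integralState_apply (μ : Measure Ω) [IsProbabilityMeasure μ] (g : C(Ω, ℝ)) :
    integralState μ g = ∫ ω, g ω ∂μ := rfl

theorem integralState_injective {μ ν : Measure Ω} [IsProbabilityMeasure μ]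
    [IsProbabilityMeasure ν] (h : integralState μ = integralState ν) : μ = ν := by
  refine ext_of_forall_integral_eq_of_IsFiniteMeasure fun f => ?_
  exact DFunLike.congr_fun h f.toContinuousMap

theorem exists_integralState_eq {L : WeakDual ℝ C(Ω, ℝ)} (hL : L ∈ states Ω) :
    ∃ (μ : Measure Ω) (_ : IsProbabilityMeasure μ), integralState μ = L := by
  let Λ : CompactlySupportedContinuousMap Ω ℝ →ₚ[ℝ] ℝ := PositiveLinearMap.mk₀
    { toFun := fun f => L f.toContinuousMap
      map_add' := fun f g => map_add L f.toContinuousMap g.toContinuousMap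
      map_smul' := fun r f => map_smul L r f.toContinuousMap }
    (fun f hf => hL.1 _ hf)
  have key : ∀ g : C(Ω, ℝ), ∫ ω, g ω ∂(RealRMK.rieszMeasure Λ) = L g := fun g =>
    RealRMK.integral_rieszMeasure Λ (CompactlySupportedContinuousMap.continuousMapEquiv g)
  have hprob : IsProbabilityMeasure (RealRMK.rieszMeasure Λ) := by
    have h1 := key 1
    rw [hL.2] at h1
    simp only [ContinuousMap.one_apply, integral_const, smul_eq_mul, mul_one] at h1
    constructor
    rwa [measureReal_def, ENNReal.toReal_eq_one_iff] at h1
  exact ⟨_, hprob, DFunLike.ext _ _ key⟩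

theorem integralState_mem_invariantStates {φ : Flow ℝ Ω} {μ : Measure Ω} [IsProbabilityMeasure μ]
    (h : ∀ t : ℝ, MeasurePreserving (φ t) μ μ) : integralState μ ∈ invariantStates φ := by
  refine ⟨⟨fun g hg => integral_nonneg hg, by simp⟩, fun t g => ?_⟩
  simp only [integralState_apply, ContinuousMap.compFlow_apply]
  rw [← integral_map (f := fun ω => g ω) (h t).measurable.aemeasurable
    g.continuous.aestronglyMeasurable, (h t).map_eq]

theorem measurePreserving_of_integralState_mem {φ : Flow ℝ Ω} {μ : Measure Ω}
    [IsProbabilityMeasure μ] (h : integralState μ ∈ invariantStates φ) (t : ℝ) :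
    MeasurePreserving (φ t) μ μ := by
  have hm : Measurable (φ t) := (φ.continuous_toFun t).measurable
  refine ⟨hm, ?_⟩
  have := Measure.isProbabilityMeasure_map (μ := μ) hm.aemeasurable
  refine integralState_injective (DFunLike.ext _ _ fun g => ?_)
  rw [← h.2 t g]
  simp only [integralState_apply, ContinuousMap.compFlow_apply]
  exact integral_map hm.aemeasurable g.continuous.aestronglyMeasurable

/-- An invariant set of intermediate measure would write `μ` as a proper convex combination of its
conditionals on the set and on the complement. Extremality would equate `μ` with the first, which
does not charge the complement. -/
theorem isErgodicMeasure_of_mem_extremePoints {φ : Flow ℝ Ω} {μ : Measure Ω}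
    [IsProbabilityMeasure μ] (h : integralState μ ∈ (invariantStates φ).extremePoints ℝ) :
    IsErgodicMeasure φ μ := by
  have hinv := measurePreserving_of_integralState_mem h.1
  refine ⟨inferInstance, hinv, fun B hBm hB => ?_⟩
  by_contra! hcon
  obtain ⟨h0, h1⟩ := hcon
  have hBc : μ Bᶜ ≠ 0 := by
    rwa [Ne, prob_compl_eq_zero_iff hBm]
  have hBi := preimage_eq_of_image_eq hB
  have hBci : ∀ t : ℝ, φ t ⁻¹' Bᶜ = Bᶜ := fun t => by rw [preimage_compl, hBi t]
  have hP1 := ProbabilityTheory.cond_isProbabilityMeasure h0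
  have hP2 := ProbabilityTheory.cond_isProbabilityMeasure hBc
  have hm1 := integralState_mem_invariantStates (measurePreserving_cond hinv hBm hBi)
  have hm2 := integralState_mem_invariantStates (measurePreserving_cond hinv hBm.compl hBci)
  have hseg : integralState μ ∈ openSegment ℝ (integralState (ProbabilityTheory.cond μ B))
      (integralState (ProbabilityTheory.cond μ Bᶜ)) := by
    refine ⟨μ.real B, μ.real Bᶜ, ?_, ?_, ?_, ?_⟩
    · exact ENNReal.toReal_pos h0 (measure_ne_top _ _)
    · exact ENNReal.toReal_pos hBc (measure_ne_top _ _)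
    · exact probReal_add_probReal_compl hBm
    · refine DFunLike.ext _ _ fun g => ?_
      change μ.real B * (∫ ω, g ω ∂(ProbabilityTheory.cond μ B)) +
        μ.real Bᶜ * (∫ ω, g ω ∂(ProbabilityTheory.cond μ Bᶜ)) = ∫ ω, g ω ∂μ
      have hg : Integrable (fun ω => g ω) μ :=
        g.continuous.integrable_of_hasCompactSupport (HasCompactSupport.of_compactSpace _)
      have hB0 : μ.real B ≠ 0 := (ENNReal.toReal_pos h0 (measure_ne_top _ _)).ne'
      have hBc0 : μ.real Bᶜ ≠ 0 := (ENNReal.toReal_pos hBc (measure_ne_top _ _)).ne'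
      rw [ProbabilityTheory.cond, ProbabilityTheory.cond, integral_smul_measure,
        integral_smul_measure, ENNReal.toReal_inv, ENNReal.toReal_inv, smul_eq_mul, smul_eq_mul]
      rw [← measureReal_def, ← measureReal_def, mul_inv_cancel_left₀ hB0,
        mul_inv_cancel_left₀ hBc0]
      exact integral_add_compl hBm hg
  have heq := integralState_injective (h.2 hm1 hm2 hseg)
  have h3 : ProbabilityTheory.cond μ B Bᶜ = 0 := by
    rw [ProbabilityTheory.cond_apply hBm]
    simp
  rw [heq] at h3
  exact hBc h3

/-- A function with mean zero for every ergodic measure is annihilated by the invariant states. -/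
theorem apply_eq_zero_of_mem_zeroMeanFunctions {φ : Flow ℝ Ω} {f : C(Ω, ℝ)}
    (hf : f ∈ zeroMeanFunctions φ) {L : WeakDual ℝ C(Ω, ℝ)} (hL : L ∈ invariantStates φ) :
    L f = 0 := by
  have : LocallyConvexSpace ℝ (WeakDual ℝ C(Ω, ℝ)) :=
    inferInstanceAs (LocallyConvexSpace ℝ (WeakBilin (topDualPairing ℝ C(Ω, ℝ))))
  rw [← closure_convexHull_extremePoints (isCompact_invariantStates φ)
    (convex_invariantStates φ)] at hL
  have hclosed : IsClosed {M : WeakDual ℝ C(Ω, ℝ) | M f = 0} :=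
    isClosed_eq (WeakDual.eval_continuous f) continuous_const
  refine closure_minimal (convexHull_min ?_ ?_) hclosed hL
  · intro M hM
    obtain ⟨μ, hμ, rfl⟩ := exists_integralState_eq hM.1.1
    exact hf μ (isErgodicMeasure_of_mem_extremePoints hM)
  · intro M hM N hN a b _ _ _
    change a * M f + b * N f = 0
    rw [show M f = 0 from hM, show N f = 0 from hN]
    simp

end Riesz

/-! ### Uniform sublinear growth of integrals along orbits. -/

section Averages

variable {Ω : Type*} [TopologicalSpace Ω] [CompactSpace Ω]

/-- The average of continuous functions along the orbit segment of `ω` from time `0` to `t`. -/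
noncomputable def orbitAverage (φ : Flow ℝ Ω) (ω : Ω) (t : ℝ) : WeakDual ℝ C(Ω, ℝ) :=
  have hint (g : C(Ω, ℝ)) : IntervalIntegrable (fun u : ℝ => g (φ (t * u) ω)) volume 0 1 :=
    Continuous.intervalIntegrable (by fun_prop) _ _
  WeakDual.ofPositive
    { toFun := fun g => ∫ u in (0 : ℝ)..1, g (φ (t * u) ω)
      map_add' := fun f g => intervalIntegral.integral_add (hint f) (hint g)
      map_smul' := fun r g =>
        intervalIntegral.integral_const_mul r fun u => g (φ (t * u) ω) }
    (fun _ hg => intervalIntegral.integral_nonneg zero_le_one fun _ _ => hg _) (by simp)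

theorem orbitAverage_apply (φ : Flow ℝ Ω) (ω : Ω) (t : ℝ) (g : C(Ω, ℝ)) :
    orbitAverage φ ω t g = ∫ u in (0 : ℝ)..1, g (φ (t * u) ω) := rfl

/-- Rescaling time to `[0,1]` makes `orbitAverage` a state for every real `t`, including `t ≤ 0`;
this recovers the unscaled integral. -/
theorem mul_orbitAverage (φ : Flow ℝ Ω) (ω : Ω) (t : ℝ) (g : C(Ω, ℝ)) :
    t * orbitAverage φ ω t g = ∫ s in (0 : ℝ)..t, g (φ s ω) := by
  rw [orbitAverage_apply]
  simpa using intervalIntegral.mul_integral_comp_mul_left (a := 0) (b := 1) (c := t)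
    (f := fun s => g (φ s ω))

theorem orbitAverage_mem_states (φ : Flow ℝ Ω) (ω : Ω) (t : ℝ) :
    orbitAverage φ ω t ∈ states Ω :=
  ⟨fun _ hg => intervalIntegral.integral_nonneg zero_le_one fun _ _ => hg _, by
    simp [orbitAverage_apply]⟩

theorem abs_integral_orbit_le (φ : Flow ℝ Ω) (ω : Ω) (a b : ℝ) (g : C(Ω, ℝ)) :
    |∫ s in a..b, g (φ s ω)| ≤ ‖g‖ * |b - a| :=
  intervalIntegral.norm_integral_le_of_norm_le_const fun s _ => g.norm_coe_le_norm (φ s ω)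

/-- A time shift by `τ` changes the integral only by two end pieces of length `|τ|`. Limits of
averages as `|t| → ∞` are therefore invariant. -/
theorem abs_mul_orbitAverage_compFlow_sub (φ : Flow ℝ Ω) (ω : Ω) (t τ : ℝ) (g : C(Ω, ℝ)) :
    |t| * |orbitAverage φ ω t (g.compFlow φ τ) - orbitAverage φ ω t g| ≤ 2 * ‖g‖ * |τ| := by
  have hint (a b : ℝ) : IntervalIntegrable (fun s : ℝ => g (φ s ω)) volume a b :=
    (φ.continuous_comp_orbit g ω).intervalIntegrable _ _
  have h1 : ∫ s in (0 : ℝ)..t, g.compFlow φ τ (φ s ω) = ∫ s in τ..(t + τ), g (φ s ω) := by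
    have := intervalIntegral.integral_comp_add_right (a := 0) (b := t)
      (fun s => g (φ s ω)) τ
    rw [zero_add] at this
    rw [← this]
    refine intervalIntegral.integral_congr fun s _ => ?_
    simp only [ContinuousMap.compFlow_apply]
    rw [← φ.map_add, add_comm]
  have h2 : (∫ s in τ..(t + τ), g (φ s ω)) - ∫ s in (0 : ℝ)..t, g (φ s ω) =
      (∫ s in t..(t + τ), g (φ s ω)) - ∫ s in (0 : ℝ)..τ, g (φ s ω) := by
    have h3 := intervalIntegral.integral_add_adjacent_intervals (hint 0 τ) (hint τ (t + τ))
    have h4 := intervalIntegral.integral_add_adjacent_intervals (hint 0 t) (hint t (t + τ))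
    linarith
  rw [← abs_mul, mul_sub, mul_orbitAverage, mul_orbitAverage, h1, h2]
  have h5 := abs_integral_orbit_le φ ω t (t + τ) g
  have h6 := abs_integral_orbit_le φ ω 0 τ g
  rw [add_sub_cancel_left] at h5
  rw [sub_zero] at h6
  rw [abs_le] at h5 h6 ⊢
  constructor <;> linarith

/-- The integrals along orbits of a continuous function that is annihilated by all invariant states
grow sublinearly, uniformly in the initial point. -/
theorem exists_abs_integral_orbit_le (φ : Flow ℝ Ω) {f : C(Ω, ℝ)}
    (hf : ∀ L ∈ invariantStates φ, L f = 0) {δ : ℝ} (hδ : 0 < δ) :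
    ∃ K : ℝ, ∀ (ω : Ω) (t : ℝ), |∫ s in (0 : ℝ)..t, f (φ s ω)| ≤ δ * |t| + K := by
  by_contra! hcon
  -- Failure for each `K = k` yields orbit segments of unbounded length with averages at least `δ`
  -- in absolute value. A limit of these averages along an ultrafilter is an invariant state not
  -- vanishing at `f`.
  choose ω t hωt using fun k : ℕ => hcon k
  have ht : Filter.Tendsto (fun k => |t k|) Filter.atTop Filter.atTop := by
    have hpos : 0 < ‖f‖ + 1 := by positivity
    refine Filter.tendsto_atTop_mono (f := fun k : ℕ => (k : ℝ) / (‖f‖ + 1)) (fun k => ?_)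
      (tendsto_natCast_atTop_atTop.atTop_div_const hpos)
    have h1 := abs_integral_orbit_le φ (ω k) 0 (t k) f
    rw [sub_zero] at h1
    have h2 := hωt k
    have h3 := abs_nonneg (t k)
    rw [div_le_iff₀ hpos]
    nlinarith
  have hav : ∀ k, δ ≤ |orbitAverage φ (ω k) (t k) f| := fun k => by
    have h1 := hωt k
    rw [← mul_orbitAverage, abs_mul] at h1
    have h2 : (0 : ℝ) ≤ k := k.cast_nonneg
    by_contra! h3
    nlinarith [abs_nonneg (t k)]
  obtain ⟨L, hL, hLlim⟩ := isCompact_states.ultrafilter_le_nhds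
    ((Filter.hyperfilter ℕ).map fun k => orbitAverage φ (ω k) (t k))
    (Filter.le_principal_iff.2 (Filter.mem_map.2
      (Filter.Eventually.of_forall fun k => orbitAverage_mem_states φ (ω k) (t k))))
  have hlim : ∀ g : C(Ω, ℝ), Filter.Tendsto (fun k => orbitAverage φ (ω k) (t k) g)
      (Filter.hyperfilter ℕ : Filter ℕ) (nhds (L g)) := fun g =>
    ((WeakDual.eval_continuous g).tendsto L).comp hLlim
  have hhyp : (Filter.hyperfilter ℕ : Filter ℕ) ≤ Filter.atTop := by
    rw [← Nat.cofinite_eq_atTop]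
    exact Filter.hyperfilter_le_cofinite
  have hLinv : L ∈ invariantStates φ := by
    refine ⟨hL, fun τ g => ?_⟩
    rw [← sub_eq_zero]
    refine tendsto_nhds_unique ((hlim (g.compFlow φ τ)).sub (hlim g)) ?_
    have h1 : Filter.Tendsto (fun k => 2 * ‖g‖ * |τ| / |t k|) Filter.atTop (nhds 0) :=
      tendsto_const_nhds.div_atTop ht
    refine squeeze_zero_norm' ?_ (h1.mono_left hhyp)
    refine Filter.Eventually.filter_mono hhyp ?_
    filter_upwards [ht.eventually_gt_atTop 0] with k hk
    rw [Real.norm_eq_abs, le_div_iff₀ hk, mul_comm]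
    exact abs_mul_orbitAverage_compFlow_sub φ (ω k) (t k) τ g
  have h2 : δ ≤ |L f| := ge_of_tendsto' (hlim f).abs hav
  rw [hf L hLinv, abs_zero] at h2
  linarith

end Averages

/-! ### Invariance of the spectrum under `C₀(Ω)`. -/

section Spectrum

variable {Ω : Type*} [MetricSpace Ω] [CompactSpace Ω] [MeasurableSpace Ω] [BorelSpace Ω]

/-- The integral of `a - b` is at most `δ / 2 * |t| + K` in absolute value: the linear term uses up
half of the rate, and `K` goes into the constant. Taking `max K 0` keeps that constant at least `1`.
-/
theorem HasExponentialDichotomy.of_sub_mem {φ : Flow ℝ Ω} {a b : C(Ω, ℝ)}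
    (ha : HasExponentialDichotomy φ a) (hab : a - b ∈ zeroMeanFunctions φ) :
    HasExponentialDichotomy φ b := by
  obtain ⟨k, δ, hk, hδ, h⟩ := ha
  obtain ⟨K, hK⟩ := exists_abs_integral_orbit_le φ
    (fun L hL => apply_eq_zero_of_mem_zeroMeanFunctions hab hL) (half_pos hδ)
  have key : ∀ (ω : Ω) (t : ℝ), Real.exp (∫ s in (0 : ℝ)..t, a (φ s ω)) ≤
      k * Real.exp (-δ * |t|) → Real.exp (∫ s in (0 : ℝ)..t, b (φ s ω)) ≤
      k * Real.exp (max K 0) * Real.exp (-(δ / 2) * |t|) := by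
    intro ω t hat
    have h1 := hK ω t
    have h2 : ∫ s in (0 : ℝ)..t, (a - b) (φ s ω) =
        (∫ s in (0 : ℝ)..t, a (φ s ω)) - ∫ s in (0 : ℝ)..t, b (φ s ω) :=
      intervalIntegral.integral_sub ((φ.continuous_comp_orbit a ω).intervalIntegrable _ _)
        ((φ.continuous_comp_orbit b ω).intervalIntegrable _ _)
    rw [h2] at h1
    have h3 := (abs_le.1 h1).1
    have h4 := le_max_left K 0
    calc Real.exp (∫ s in (0 : ℝ)..t, b (φ s ω))
        ≤ Real.exp ((∫ s in (0 : ℝ)..t, a (φ s ω)) + (δ / 2 * |t| + max K 0)) :=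
          Real.exp_le_exp.2 (by linarith)
      _ = Real.exp (∫ s in (0 : ℝ)..t, a (φ s ω)) * Real.exp (δ / 2 * |t| + max K 0) :=
          Real.exp_add _ _
      _ ≤ k * Real.exp (-δ * |t|) * Real.exp (δ / 2 * |t| + max K 0) := by gcongr
      _ = k * Real.exp (max K 0) * Real.exp (-(δ / 2) * |t|) := by
          rw [mul_assoc, mul_assoc, ← Real.exp_add, ← Real.exp_add]
          congr 2
          ring
  refine ⟨k * Real.exp (max K 0), δ / 2, ?_, half_pos hδ, ?_⟩
  · exact one_le_mul_of_one_le_of_one_le hk (Real.one_le_exp (le_max_right _ _))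
  · refine h.imp (fun h ω t ht => ?_) fun h ω t ht => ?_
    · have := key ω t
      rw [abs_of_nonneg ht] at this
      exact this (h ω t ht)
    · have := key ω t
      rw [abs_of_nonpos ht, neg_mul_neg, neg_mul_neg] at this
      exact this (h ω t ht)

theorem sackerSellSpectrum_eq_of_sub_mem {φ : Flow ℝ Ω} {a b : C(Ω, ℝ)}
    (hab : a - b ∈ zeroMeanFunctions φ) : sackerSellSpectrum φ a = sackerSellSpectrum φ b := by
  ext r
  refine not_congr ⟨fun h => h.of_sub_mem ?_, fun h => h.of_sub_mem ?_⟩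
  · rwa [sub_sub_sub_cancel_right]
  · rw [sub_sub_sub_cancel_right, ← neg_sub]
    exact neg_mem hab

end Spectrum

/-! ### The topological direct sum. -/

section Decomposition

/-- Column dominance needs `(n - 1) * ε < 1 - ε`, which is exactly `ε * n < 1`. -/
theorem IsSeparatingFamily.det_ne_zero {Ω : Type*} [MetricSpace Ω] [MeasurableSpace Ω] {n : ℕ} {m : Fin n → Measure Ω} {ε : ℝ}
    {c : Fin n → C(Ω, ℝ)} (hc : IsSeparatingFamily m ε c) (hε : ε * n < 1) :
    (Matrix.of fun j i => ∫ ω, c i ω ∂(m j)).det ≠ 0 := by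
  refine det_ne_zero_of_sum_col_lt_diag fun i => ?_
  simp only [Matrix.of_apply, Real.norm_eq_abs]
  have hn : 1 ≤ n := by have := i.2; omega
  calc ∑ j ∈ Finset.univ.erase i, |∫ ω, c i ω ∂(m j)|
      ≤ ∑ j ∈ Finset.univ.erase i, ε := Finset.sum_le_sum fun j hj => by
        have := hc.integral_other i j (Finset.ne_of_mem_erase hj)
        rw [abs_of_nonneg this.1]
        exact this.2.le
    _ = (n - 1) * ε := by
        rw [Finset.sum_const, Finset.card_erase_of_mem (Finset.mem_univ _), Finset.card_univ,
          Fintype.card_fin, nsmul_eq_mul, Nat.cast_sub hn, Nat.cast_one]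
    _ < 1 - ε := by linarith
    _ < ∫ ω, c i ω ∂(m i) := (hc.integral_self i).1
    _ ≤ |∫ ω, c i ω ∂(m i)| := le_abs_self _

variable {Ω : Type*} [MetricSpace Ω] [CompactSpace Ω] [MeasurableSpace Ω] [BorelSpace Ω]

/-- With `I` the vector of integrals, `f₂ = M⁻¹ ∘ I` is a continuous left inverse of the synthesis
map `f₁`; the range of `f₁` and the kernel of `f₂` are the two summands. -/
theorem IsSeparatingFamily.isTopCompl {φ : Flow ℝ Ω} {n : ℕ} {m : Fin n → Measure Ω}
    (hm : range m = ergodicMeasures φ) {ε : ℝ} {c : Fin n → C(Ω, ℝ)}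
    (hc : IsSeparatingFamily m ε c) (hε : ε * n < 1) :
    Submodule.IsTopCompl (Submodule.span ℝ (range c)) (zeroMeanFunctions φ) := by
  have hprob : ∀ i, IsProbabilityMeasure (m i) := fun i =>
    (show m i ∈ ergodicMeasures φ from hm ▸ mem_range_self i).isProbabilityMeasure
  let M : Matrix (Fin n) (Fin n) ℝ := Matrix.of fun j i => ∫ ω, c i ω ∂(m j)
  have hM : IsUnit M.det := (hc.det_ne_zero hε).isUnit
  let I : C(Ω, ℝ) →L[ℝ] (Fin n → ℝ) :=
    ContinuousLinearMap.pi fun j => WeakDual.toStrongDual (integralState (m j))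
  have hI : ∀ g j, I g j = ∫ ω, g ω ∂(m j) := fun g j => rfl
  let f₁ : (Fin n → ℝ) →L[ℝ] C(Ω, ℝ) := (Fintype.linearCombination ℝ c).toContinuousLinearMap
  let f₂ : C(Ω, ℝ) →L[ℝ] (Fin n → ℝ) := (M⁻¹.mulVecLin).toContinuousLinearMap ∘L I
  have hI₁ : ∀ v, I (f₁ v) = M.mulVec v := fun v => by
    have h1 : f₁ v = ∑ i, v i • c i := Fintype.linearCombination_apply ℝ c v
    rw [h1, map_sum]
    ext j
    simp only [map_smul, Finset.sum_apply, Pi.smul_apply, hI, smul_eq_mul, Matrix.mulVec,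
      dotProduct, M, Matrix.of_apply]
    exact Finset.sum_congr rfl fun i _ => mul_comm _ _
  have hinv : Function.LeftInverse f₂ f₁ := fun v => by
    change M⁻¹.mulVec (I (f₁ v)) = v
    rw [hI₁, Matrix.mulVec_mulVec, Matrix.nonsing_inv_mul _ hM, Matrix.one_mulVec]
  have key := f₁.isTopCompl_range_ker_of_leftInverse f₂ hinv
  have hrange : f₁.range = Submodule.span ℝ (range c) := Fintype.range_linearCombination ℝ c
  have hker : f₂.ker = zeroMeanFunctions φ := by
    ext g
    have h1 : f₂ g = 0 ↔ I g = 0 := by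
      refine ⟨fun h => ?_, fun h => ?_⟩
      · have h2 := congrArg M.mulVec (show M⁻¹.mulVec (I g) = 0 from h)
        rwa [Matrix.mulVec_mulVec, Matrix.mul_nonsing_inv _ hM, Matrix.one_mulVec,
          Matrix.mulVec_zero] at h2
      · change M⁻¹.mulVec (I g) = 0
        rw [h, Matrix.mulVec_zero]
    change f₂ g = 0 ↔ ∀ μ ∈ ergodicMeasures φ, ∫ ω, g ω ∂μ = 0
    rw [h1, ← hm, forall_mem_range, funext_iff]
    rfl
  rwa [hrange, hker] at key

end Decomposition

theorem mainTheorem12 {Ω : Type*} [MetricSpace Ω] [CompactSpace Ω] [MeasurableSpace Ω]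
    [BorelSpace Ω] (φ : Flow ℝ Ω) (hφ : IsMinimalFlow φ) (n : ℕ) (hn : 1 ≤ n)
    (m : Fin n → Measure Ω) (hm_inj : Function.Injective m)
    (hm : Set.range m = ergodicMeasures φ) :
    ∃ ε₂ : ℝ, 0 < ε₂ ∧ ε₂ < 1 ∧ ∀ ε : ℝ, 0 < ε → ε ≤ ε₂ →
      (Nontrivial Ω → ∃ c : Fin n → C(Ω, ℝ), IsSeparatingFamily m ε c) ∧
      ∀ c : Fin n → C(Ω, ℝ), IsSeparatingFamily m ε c →
        ∃ h : Submodule.IsTopCompl (Submodule.span ℝ (Set.range c)) (zeroMeanFunctions φ),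
          ∀ a : C(Ω, ℝ),
            sackerSellSpectrum φ a =
              sackerSellSpectrum φ
                (Submodule.projectionL (Submodule.span ℝ (Set.range c)) (zeroMeanFunctions φ)
                  h a) := by
  have herg : ∀ i, IsErgodicMeasure φ (m i) := fun i =>
    show m i ∈ ergodicMeasures φ from hm ▸ mem_range_self i
  have hprob : ∀ i, IsProbabilityMeasure (m i) := fun i => (herg i).isProbabilityMeasure
  have hn' : (1 : ℝ) ≤ n := by exact_mod_cast hn
  have hlt : 1 / ((n : ℝ) + 1) < 1 := by
    rw [div_lt_one (by linarith)]
    linarith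
  -- The value `1 / (n + 1)` ensures `ε * n < 1` and stays below `1` also for `n = 1`.
  refine ⟨1 / (n + 1), by positivity, hlt, fun ε hε hεn => ⟨fun _ => ?_, fun c hc => ?_⟩⟩
  · obtain ⟨x⟩ : Nonempty Ω := inferInstance
    exact exists_isSeparatingFamily
      (fun i j hij => (herg i).mutuallySingular (herg j) (hm_inj.ne hij))
      (fun i => (herg i).measure_singleton hφ x) hε (hεn.trans_lt hlt)
  · have hεn' : ε * n < 1 := by
      rw [le_div_iff₀ (by linarith)] at hεn
      linarith
    have h := hc.isTopCompl hm hεn'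
    refine ⟨h, fun a => sackerSellSpectrum_eq_of_sub_mem ?_⟩
    -- Idempotence of the projection puts `a - P a` in its kernel `C₀(Ω)`.
    rw [← Submodule.projectionL_apply_eq_zero_iff h]
    have h1 := Submodule.projectionL_apply_left h
      ⟨_, Submodule.projectionL_apply_mem h a⟩
    simp only at h1
    rw [map_sub, h1, sub_self]
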